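/- Let $M\subseteq B(H)$ be a II$_1$ factor, that is, an infinite-dimensional von Neumann algebra on a complex Hilbert space $H$ whose center is $\mathbb{C}1$ and which has a faithful normal tracial state $\tau$ (which is then unique); put $\|x\|_2=\tau(x^*x)^{1/2}$. View $M$ as a structure of continuous logic in the language of tracial von Neumann algebras: the domains of quantification are the operator-norm balls $D_N=\{x\in M:\|x\|\le N\}$, $N=1,2,\dots$, terms are built from variables and parameters in $M$ by $0$, $1$, $+$, $\cdot$, ${}^*$ and multiplication by complex scalars; atomic formulas are $\|s-t\|_2$, $\operatorname{Re}\tau(t)$ and $\operatorname{Im}\tau(t)$ for terms $s,t$; and formulas are built from atomic ones by continuous functions $\mathbb{R}^k\to\mathbb{R}$ and by the quantifiers $\sup_{x\in D_N}$ and $\inf_{x\in D_N}$. Suppose that $M$ is countably saturated: whenever $X\subseteq M$ is countable, $n\ge 0$ and $N_0,\dots,N_{n-1}\ge 1$ are integers, and $p$ is a set of conditions $\varphi(x_0,\dots,x_{n-1})=r$, with $\varphi$ a formula with parameters in $X$ and $r\in\mathbb{R}$, such that for every finite $p_0\subseteq p$ and every $\varepsilon>0$ there is $v\in D_{N_0}\times\dots\times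 D_{N_{n-1}}$ with $|\varphi(v)-r|<\varepsilon$ for all conditions $\varphi=r$ in $p_0$, there is $v\in D_{N_0}\times\dots\times D_{N_{n-1}}$ with $\varphi(v)=r$ for all conditions $\varphi=r$ in $p$. Let $\beta$ be a $*$-automorphism of $M$ and let $a\in M$ be normal, $a^*a=aa^*$. Then there is a unitary $u\in M$ with $uau^*=\beta(a)$. -/

import Mathlib

/-! ## II₁ factors -/

/-- `M ⊆ B(H)` is a factor: its center consists of the scalar multiples of the identity only. -/
def VonNeumannAlgebra.IsFactor {H : Type*} [NormedAddCommGroup H] [InnerProductSpace ℂ H]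
    [CompleteSpace H] (M : VonNeumannAlgebra H) : Prop :=
  ∀ z : M.toStarSubalgebra, (∀ x : M.toStarSubalgebra, z * x = x * z) →
    ∃ c : ℂ, z = algebraMap ℂ M.toStarSubalgebra c

/-- `τ` is a faithful normal tracial state on the von Neumann algebra `M`. -/
structure IsFaithfulNormalTrace {H : Type*} [NormedAddCommGroup H] [InnerProductSpace ℂ H]
    [CompleteSpace H] (M : VonNeumannAlgebra H) (τ : M.toStarSubalgebra →ₗ[ℂ] ℂ) : Prop where
  map_one : τ 1 = 1
  nonneg : ∀ x, 0 ≤ (τ (star x * x)).re ∧ (τ (star x * x)).im = 0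
  tracial : ∀ x y, τ (x * y) = τ (y * x)
  faithful : ∀ x, τ (star x * x) = 0 → x = 0
  /-- `τ` preserves suprema of upward directed families of self-adjoint elements of `M`; the order
  is the usual one of operators, `x ≤ y` iff `y - x` is positive. -/
  normal : ∀ (S : Set M.toStarSubalgebra) (s : M.toStarSubalgebra), S.Nonempty →
    DirectedOn (· ≤ ·) S → (∀ x ∈ S, IsSelfAdjoint x) → IsLUB S s →
    IsLUB ((fun x => (τ x).re) '' S) (τ s).re

/-- `(M, τ)` is a II₁ factor with its trace: `M` is an infinite-dimensional factor and `τ` is a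
faithful normal tracial state on `M`. -/
structure IsTypeIIOneFactor {H : Type*} [NormedAddCommGroup H] [InnerProductSpace ℂ H]
    [CompleteSpace H] (M : VonNeumannAlgebra H) (τ : M.toStarSubalgebra →ₗ[ℂ] ℂ) : Prop where
  isFactor : M.IsFactor
  infinite_dimensional : ¬ FiniteDimensional ℂ M.toStarSubalgebra
  isTrace : IsFaithfulNormalTrace M τ

/-! ## The continuous logic of tracial von Neumann algebras

There is one sort. Its domains of quantification are the closed operator-norm balls `D_N` of radius
`N = 1, 2, …`, its metric is the distance of the `2`-norm, its function symbols are the operations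
of a unital `*`-algebra over `ℂ`, and its predicate symbols are the real and imaginary parts of the
trace. -/

/-- Terms in the free variables `x_0, …, x_{n-1}`, with parameters from `P`. -/
inductive TracialTerm (P : Type*) (n : ℕ) where
  | var (i : Fin n) : TracialTerm P n
  | param (p : P) : TracialTerm P n
  | zero : TracialTerm P n
  | one : TracialTerm P n
  | add (s t : TracialTerm P n) : TracialTerm P n
  | mul (s t : TracialTerm P n) : TracialTerm P n
  | smul (c : ℂ) (t : TracialTerm P n) : TracialTerm P n
  | star (t : TracialTerm P n) : TracialTerm P n

/-- Formulas in the free variables `x_0, …, x_{n-1}`, with parameters from `P`. Connectives are all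
continuous functions `ℝ^k → ℝ`; the quantifiers `sup` and `inf` bind the last variable `x_n` of a
formula in `n + 1` variables, which ranges over the domain `D_N`. -/
inductive TracialFormula (P : Type*) : ℕ → Type _ where
  | dist {n : ℕ} (s t : TracialTerm P n) : TracialFormula P n
  | reTrace {n : ℕ} (t : TracialTerm P n) : TracialFormula P n
  | imTrace {n : ℕ} (t : TracialTerm P n) : TracialFormula P n
  | conn {n k : ℕ} (f : C(Fin k → ℝ, ℝ)) (φ : Fin k → TracialFormula P n) : TracialFormula P n
  | sup {n : ℕ} (N : ℕ+) (φ : TracialFormula P (n + 1)) : TracialFormula P n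
  | inf {n : ℕ} (N : ℕ+) (φ : TracialFormula P (n + 1)) : TracialFormula P n

namespace VonNeumannAlgebra

/-- The `2`-norm (Hilbert–Schmidt norm) `‖x‖₂ = τ(x* x)^{1/2}` of a trace `τ` on `M`. -/
noncomputable def twoNorm {H : Type*} [NormedAddCommGroup H] [InnerProductSpace ℂ H]
    [CompleteSpace H] {M : VonNeumannAlgebra H} (τ : M.toStarSubalgebra →ₗ[ℂ] ℂ)
    (x : M.toStarSubalgebra) : ℝ :=
  Real.sqrt (τ (star x * x)).re

/-- The domain `D_N` of `M`: the closed ball of radius `N` in the operator norm. -/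
def domainBall {H : Type*} [NormedAddCommGroup H] [InnerProductSpace ℂ H]
    [CompleteSpace H] (M : VonNeumannAlgebra H) (N : ℕ+) : Set M.toStarSubalgebra :=
  {x | ‖(x : H →L[ℂ] H)‖ ≤ ((N : ℕ) : ℝ)}

/-- The element of `M` denoted by a term, when the variables take the values `v` and the parameters
come from a subset `X` of `M`. -/
noncomputable def termVal {H : Type*} [NormedAddCommGroup H] [InnerProductSpace ℂ H]
    [CompleteSpace H] {M : VonNeumannAlgebra H} {X : Set M.toStarSubalgebra} {n : ℕ}
    (v : Fin n → M.toStarSubalgebra) : TracialTerm X n → M.toStarSubalgebra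
  | .var i => v i
  | .param p => p
  | .zero => 0
  | .one => 1
  | .add s t => termVal v s + termVal v t
  | .mul s t => termVal v s * termVal v t
  | .smul c t => c • termVal v t
  | .star t => star (termVal v t)

/-- The real value of a formula in the tracial von Neumann algebra `(M, τ)`. On a domain `D_N` the
values of a formula are bounded (terms are bounded there in operator norm, and continuous functions
map bounded sets to bounded sets), so that the suprema and infima are those of nonempty bounded sets
of reals. -/
noncomputable def formulaVal {H : Type*} [NormedAddCommGroup H] [InnerProductSpace ℂ H]
    [CompleteSpace H] {M : VonNeumannAlgebra H} (τ : M.toStarSubalgebra →ₗ[ℂ] ℂ)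
    {X : Set M.toStarSubalgebra} :
    {n : ℕ} → TracialFormula X n → (Fin n → M.toStarSubalgebra) → ℝ
  | _, .dist s t, v => twoNorm τ (termVal v s - termVal v t)
  | _, .reTrace t, v => (τ (termVal v t)).re
  | _, .imTrace t, v => (τ (termVal v t)).im
  | _, .conn f φ, v => f fun i => formulaVal τ (φ i) v
  | _, .sup N φ, v => ⨆ x : M.domainBall N, formulaVal τ φ (Fin.snoc v (x : M.toStarSubalgebra))
  | _, .inf N φ, v => ⨅ x : M.domainBall N, formulaVal τ φ (Fin.snoc v (x : M.toStarSubalgebra))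

/-- `(M, τ)` is countably saturated: let `X` be a countable subset of `M` and let `p` be a set of
conditions `φ(x_0, …, x_{n-1}) = r` with parameters from `X`, on variables `x_i` that range over
domains `D_{N i}`. If all finite subsets of `p` are approximately satisfied in `M`, up to every
`ε > 0`, then `p` is realized in `M`. -/
def IsCountablySaturated {H : Type*} [NormedAddCommGroup H] [InnerProductSpace ℂ H]
    [CompleteSpace H] (M : VonNeumannAlgebra H) (τ : M.toStarSubalgebra →ₗ[ℂ] ℂ) : Prop :=
  ∀ (X : Set M.toStarSubalgebra), X.Countable →
    ∀ (n : ℕ) (N : Fin n → ℕ+) (p : Set (TracialFormula X n × ℝ)),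
      (∀ p₀ : Set (TracialFormula X n × ℝ), p₀ ⊆ p → p₀.Finite → ∀ ε : ℝ, 0 < ε →
        ∃ v : Fin n → M.toStarSubalgebra, (∀ i, v i ∈ M.domainBall (N i)) ∧
          ∀ c ∈ p₀, |formulaVal τ c.1 v - c.2| < ε) →
      ∃ v : Fin n → M.toStarSubalgebra, (∀ i, v i ∈ M.domainBall (N i)) ∧
        ∀ c ∈ p, formulaVal τ c.1 v = c.2

end VonNeumannAlgebra

/-! A trace on a II₁ factor is determined on projections by counting how many copies of a small
projection fit into them, and a `*`-automorphism preserves such counts. So `τ (β e) = τ e` for every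
projection `e`, and comparison makes `e` and `β e` Murray–von Neumann equivalent
(`trace_projection_unique`, `exists_equivalence`). Cut a normal `a` into finitely many spectral
projections `e z` on which it is nearly the scalar `z` (`exists_spectral_partition`). The sum of
partial isometries carrying `e z` to `β (e z)` is a unitary `u`, and on each block both `u a u*` and
`β a` are close to `z`. This gives `‖u a u* - β a‖₂ ≤ ε` (`exists_unitary_approx`). Saturation
enters twice: it turns approximate conjugacy into exact conjugacy, and it supplies partial
isometries of maximal trace. By primeness of a factor, the latter yield comparison of projections
(`hasComparison_of_exists_maximal`). -/

namespace VonNeumannAlgebra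

/-! ### Support projections and primeness. -/

variable {H : Type*} [NormedAddCommGroup H] [InnerProductSpace ℂ H] [CompleteSpace H]

/-- A von Neumann algebra is closed in the operator norm. -/
lemma isClosed_toStarSubalgebra (M : VonNeumannAlgebra H) :
    IsClosed (M.toStarSubalgebra : Set (H →L[ℂ] H)) := by
  rw [coe_toStarSubalgebra, ← M.centralizer_centralizer]
  exact Set.isClosed_centralizer _

/-- The projection onto the closure of a subspace invariant under the commutant of `M` lies
in `M`. -/
lemma starProjection_mem (M : VonNeumannAlgebra H) (K : Submodule ℂ H)
    (hK : ∀ y ∈ M.commutant, ∀ ξ ∈ K, y ξ ∈ K) :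
    K.topologicalClosure.starProjection ∈ M := by
  rw [IsStarProjection.mem_iff isStarProjection_starProjection]
  intro y hy
  rw [Submodule.range_starProjection, Module.End.mem_invtSubmodule]
  intro ξ hξ
  exact map_mem_closure y.continuous hξ (hK y hy)

/-- Every element of a von Neumann algebra has a left support projection. -/
lemma exists_leftSupport (M : VonNeumannAlgebra H) (x : M.toStarSubalgebra) :
    ∃ p : M.toStarSubalgebra, IsStarProjection p ∧ ∀ y, y * x = 0 ↔ y * p = 0 := by
  set K : Submodule ℂ H := LinearMap.range (x : H →L[ℂ] H).toLinearMap with hKdef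
  have hP : K.topologicalClosure.starProjection ∈ M := by
    refine M.starProjection_mem K ?_
    rintro y hy _ ⟨ξ, rfl⟩
    refine ⟨y ξ, ?_⟩
    have := mem_commutant_iff.1 hy x x.2
    exact DFunLike.congr_fun this ξ
  refine ⟨⟨_, hP⟩, ⟨?_, ?_⟩, fun y => ?_⟩
  · exact Subtype.ext K.topologicalClosure.isIdempotentElem_starProjection
  · exact Subtype.ext (isStarProjection_starProjection (U := K.topologicalClosure)).isSelfAdjoint
  · rw [Subtype.ext_iff, Subtype.ext_iff]
    change (y : H →L[ℂ] H) * x = 0 ↔ (y : H →L[ℂ] H) * K.topologicalClosure.starProjection = 0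
    constructor
    · intro h
      have hle : K.topologicalClosure ≤ LinearMap.ker (y : H →L[ℂ] H).toLinearMap := by
        refine Submodule.topologicalClosure_minimal _ ?_ (y : H →L[ℂ] H).isClosed_ker
        rintro _ ⟨ξ, rfl⟩
        exact DFunLike.congr_fun h ξ
      ext ξ
      exact hle (K.topologicalClosure.starProjection_apply_mem ξ)
    · intro h
      ext ξ
      have h1 : K.topologicalClosure.starProjection ((x : H →L[ℂ] H) ξ) = (x : H →L[ℂ] H) ξ :=
        Submodule.starProjection_eq_self_iff.2 (K.le_topologicalClosure ⟨ξ, rfl⟩)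
      have h2 := DFunLike.congr_fun h ((x : H →L[ℂ] H) ξ)
      simpa [h1] using h2

/-- A factor is a prime ring. -/
lemma IsFactor.eq_zero_or_eq_zero {M : VonNeumannAlgebra H} (hM : M.IsFactor)
    (e f : M.toStarSubalgebra) (h : ∀ y, f * y * e = 0) : e = 0 ∨ f = 0 := by
  -- The closure of `M e H` is invariant under both `M` and its commutant, so its projection `P` is
  -- central, hence a scalar `c`. Since `P e = e` and `f P = 0`, either `c = 0` kills `e` or `c ≠ 0`
  -- kills `f`.
  set K : Submodule ℂ H := Submodule.span ℂ
    {η | ∃ (y : M.toStarSubalgebra) (ξ : H), η = (y : H →L[ℂ] H) ((e : H →L[ℂ] H) ξ)} with hKdef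
  set P := K.topologicalClosure.starProjection with hPdef
  have hP : P ∈ M := by
    refine M.starProjection_mem K fun y hy ξ hξ => ?_
    refine Submodule.span_induction ?_ (by simp) (fun a b _ _ ha hb => ?_)
      (fun c a _ ha => ?_) hξ
    · rintro _ ⟨z, ξ, rfl⟩
      refine Submodule.subset_span ⟨z, y ξ, ?_⟩
      have h1 := DFunLike.congr_fun (mem_commutant_iff.1 hy z z.2) ((e : H →L[ℂ] H) ξ)
      have h2 := DFunLike.congr_fun (mem_commutant_iff.1 hy e e.2) ξ
      simp only [mul_apply_eq_comp] at h1 h2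
      rw [← h1, ← h2]
    · rw [map_add]; exact K.add_mem ha hb
    · rw [map_smul]; exact K.smul_mem c ha
  have hP' : P ∈ M.commutant := by
    refine M.commutant.starProjection_mem K fun y hy ξ hξ => ?_
    rw [commutant_commutant] at hy
    refine Submodule.span_induction ?_ (by simp) (fun a b _ _ ha hb => ?_)
      (fun c a _ ha => ?_) hξ
    · rintro _ ⟨z, ξ, rfl⟩
      exact Submodule.subset_span ⟨⟨y, hy⟩ * z, ξ, rfl⟩
    · rw [map_add]; exact K.add_mem ha hb
    · rw [map_smul]; exact K.smul_mem c ha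
  obtain ⟨c, hc⟩ := hM ⟨P, hP⟩ fun x =>
    Subtype.ext (mem_commutant_iff.1 hP' x x.2).symm
  have hc' : P = c • (1 : H →L[ℂ] H) := by
    have := congrArg Subtype.val hc
    rw [Algebra.algebraMap_eq_smul_one] at this
    exact this
  have hPe : ∀ ξ, P ((e : H →L[ℂ] H) ξ) = (e : H →L[ℂ] H) ξ := fun ξ =>
    Submodule.starProjection_eq_self_iff.2
      (K.le_topologicalClosure (Submodule.subset_span ⟨1, ξ, rfl⟩))
  have hfP : ∀ ξ, (f : H →L[ℂ] H) (P ξ) = 0 := by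
    have hle : K.topologicalClosure ≤ LinearMap.ker (f : H →L[ℂ] H).toLinearMap := by
      refine Submodule.topologicalClosure_minimal _ ?_ (f : H →L[ℂ] H).isClosed_ker
      refine Submodule.span_le.2 ?_
      rintro _ ⟨y, ξ, rfl⟩
      exact DFunLike.congr_fun (congrArg Subtype.val (h y)) ξ
    exact fun ξ => hle (K.topologicalClosure.starProjection_apply_mem ξ)
  by_cases hc0 : c = 0
  · left
    ext ξ
    rw [← hPe, hc', hc0]
    simp
  · right
    ext ξ
    have := hfP ξ
    rw [hc'] at this
    simpa [hc0] using this

end VonNeumannAlgebra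

/-! ### Algebra of projections in star rings. -/

/-- Every element of `A` has a left support projection. -/
def HasLeftSupports (A : Type*) [Mul A] [Zero A] [Star A] : Prop :=
  ∀ x : A, ∃ p : A, IsStarProjection p ∧ ∀ y, y * x = 0 ↔ y * p = 0

section Ring

variable {A : Type*} [Ring A] [StarRing A]

/-- If `z` commutes with `x`, then `1 - p` kills `z x = x z`, hence kills `z p`. Self-adjointness of
`x` allows `z = star y` as well as `z = y`, and the two identities together say that `y` commutes
with `p`. -/
lemma commute_leftSupport {x p y : A} (hp : IsStarProjection p)
    (h : ∀ y, y * x = 0 ↔ y * p = 0) (hx : IsSelfAdjoint x) (hy : Commute y x) :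
    Commute y p := by
  have key : ∀ z : A, Commute z x → p * z * p = z * p := by
    intro z hz
    have h0 : (1 - p) * x = 0 := (h _).2 hp.one_sub_mul_self
    have h1 : ((1 - p) * z) * x = 0 := by rw [mul_assoc, hz.eq, ← mul_assoc, h0, zero_mul]
    have h2 := (h _).1 h1
    rw [sub_mul, one_mul, sub_mul, sub_eq_zero] at h2
    exact h2.symm
  have hy' : Commute (star y) x := by
    have := hy.star_star
    rwa [hx.star_eq] at this
  have h1 := key y hy
  have h2 := congrArg star (key _ hy')
  simp only [star_mul, star_star, hp.isSelfAdjoint.star_eq, ← mul_assoc] at h2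
  exact h1.symm.trans h2

/-- Commuting projections can be made orthogonal without changing their supremum. -/
lemma exists_disjointed_projections {ι : Type*} [DecidableEq ι] (p : ι → A)
    (hp : ∀ i, IsStarProjection (p i)) (hc : ∀ i j, Commute (p i) (p j)) (s : Finset ι) :
    ∃ (e : ι → A) (r : A), (∀ i ∈ s, IsStarProjection (e i) ∧ p i * e i = e i) ∧
      (∀ i ∈ s, ∀ j ∈ s, i ≠ j → e i * e j = 0) ∧ ∑ i ∈ s, e i + r = 1 ∧
      IsStarProjection r ∧ (∀ i ∈ s, r * e i = 0) ∧ (∀ i ∈ s, r * p i = 0) ∧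
      ∀ y, (∀ i, Commute y (p i)) → Commute y r ∧ ∀ i ∈ s, Commute y (e i) := by
  induction s using Finset.induction_on with
  | empty => exact ⟨0, 1, by simp, by simp, by simp, .one A, by simp, by simp, by simp⟩
  | insert j s hj ih =>
    obtain ⟨e, r, h1, h2, h3, h4, h5, h6, h7⟩ := ih
    -- The clause on commuting elements, applied to `p j`, keeps the induction going: the new piece
    -- is `r * p j`, the new remainder `r * (1 - p j)`.
    have hr : Commute (p j) r := (h7 _ fun i => hc j i).1
    have hne : ∀ i ∈ s, i ≠ j := fun i hi h => hj (h ▸ hi)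
    have hre : ∀ i ∈ s, e i * r = 0 := fun i hi => by
      have := congrArg star (h5 i hi)
      simpa [(h1 i hi).1.isSelfAdjoint.star_eq, h4.isSelfAdjoint.star_eq] using this
    have hE : ∀ i ∈ s, Function.update e j (r * p j) i = e i := fun i hi =>
      Function.update_of_ne (hne i hi) _ _
    have hpr : p j * (r * p j) = r * p j := by
      rw [← mul_assoc, hr.eq, mul_assoc, (hp j).isIdempotentElem.eq]
    refine ⟨Function.update e j (r * p j), r * (1 - p j), ?_, ?_, ?_, ?_, ?_, ?_, ?_⟩
    · intro i hi
      rcases Finset.mem_insert.1 hi with rfl | hi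
      · rw [Function.update_self]
        exact ⟨h4.mul (hp i) hr.symm, hpr⟩
      · rw [hE i hi]; exact h1 i hi
    · intro i hi k hk hik
      rcases Finset.mem_insert.1 hi with rfl | hi <;> rcases Finset.mem_insert.1 hk with rfl | hk
      · exact absurd rfl hik
      · rw [Function.update_self, hE k hk, ← hr.eq, mul_assoc, h5 k hk, mul_zero]
      · have hi' := (Finset.mem_insert.1 ‹_›).resolve_left hik
        rw [Function.update_self, hE i hi', ← mul_assoc, hre i hi', zero_mul]
      · rw [hE i hi, hE k hk]; exact h2 i hi k hk hik
    · rw [Finset.sum_insert hj, Function.update_self, Finset.sum_congr rfl hE, mul_sub, mul_one, ← h3]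
      abel
    · exact h4.mul (hp j).one_sub ((Commute.one_right r).sub_right hr.symm)
    · intro i hi
      rcases Finset.mem_insert.1 hi with rfl | hi
      · rw [Function.update_self, mul_assoc, sub_mul, one_mul, hpr, sub_self, mul_zero]
      · have : r * (1 - p j) = (1 - p j) * r := ((Commute.one_right r).sub_right hr.symm).eq
        rw [hE i hi, this, mul_assoc, h5 i hi, mul_zero]
    · intro i hi
      rcases Finset.mem_insert.1 hi with rfl | hi
      · rw [mul_assoc, (hp i).one_sub_mul_self, mul_zero]
      · have : r * (1 - p j) = (1 - p j) * r := ((Commute.one_right r).sub_right hr.symm).eq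
        rw [this, mul_assoc, h6 i hi, mul_zero]
    · intro y hy
      have hyr := (h7 y hy).1
      refine ⟨hyr.mul_right ((Commute.one_right y).sub_right (hy j)), fun i hi => ?_⟩
      rcases Finset.mem_insert.1 hi with rfl | hi
      · rw [Function.update_self]; exact hyr.mul_right (hy i)
      · rw [hE i hi]; exact (h7 y hy).2 i hi

end Ring

/-! ### Spectral partitions and partial isometries by functional calculus. -/

section CStar

variable {A : Type*} [CStarAlgebra A]

/-- Approximate spectral decomposition of a normal element. -/
lemma exists_spectral_partition (hA : HasLeftSupports A) (a : A) [IsStarNormal a] {ε : ℝ}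
    (hε : 0 < ε) :
    ∃ (s : Finset ℂ) (e : ℂ → A), (∀ z ∈ s, IsStarProjection (e z)) ∧
      (∀ z ∈ s, ∀ w ∈ s, z ≠ w → e z * e w = 0) ∧ ∑ z ∈ s, e z = 1 ∧
      (∀ y, Commute y a → Commute y (star a) → ∀ z ∈ s, Commute y (e z)) ∧
      ∀ z ∈ s, ‖(a - z • 1) * e z‖ ≤ ε := by
  obtain ⟨s, hs, hcov⟩ :=
    Metric.totallyBounded_iff.1 (spectrum.isCompact (𝕜 := ℂ) a).totallyBounded ε hε
  lift s to Finset ℂ using hs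
  -- A tent supported on the `ε`-ball about `z`; the support of `g z (a)` plays the role of the
  -- spectral projection of that ball.
  set g : ℂ → ℂ → ℂ := fun z w => ((max 0 (ε - ‖w - z‖) : ℝ) : ℂ) with hg
  have hgc : ∀ z, Continuous (g z) := fun z => by fun_prop
  set x : ℂ → A := fun z => cfc (g z) a with hx
  have hxs : ∀ z, IsSelfAdjoint (x z) := fun z => by
    rw [IsSelfAdjoint, hx, ← cfc_star]
    simp [hg]
  choose p hp hpx using fun z => hA (x z)
  have hyp : ∀ y, Commute y a → Commute y (star a) → ∀ z, Commute y (p z) := fun y h1 h2 z =>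
    commute_leftSupport (hp z) (hpx z) (hxs z) (Commute.cfc h1.symm h2.symm (g z)).symm
  have hxp : ∀ z w, Commute (x z) (p w) := fun z w =>
    commute_leftSupport (hp w) (hpx w) (hxs w) (cfc_commute_cfc _ _ a)
  have hpp : ∀ z w, Commute (p z) (p w) := fun z w =>
    (commute_leftSupport (hp z) (hpx z) (hxs z) (hxp z w).symm).symm
  obtain ⟨e, r, h1, h2, h3, h4, h5, h6, h7⟩ := exists_disjointed_projections p hp hpp s
  -- The remainder kills every `x z`, hence their sum, which is invertible because the balls cover
  -- the spectrum.
  have hr : r = 0 := by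
    have hrx : ∀ z ∈ s, r * x z = 0 := fun z hz => (hpx z _).2 (h6 z hz)
    have hsum : r * cfc (fun w => ∑ z ∈ s, g z w) a = 0 := by
      have : cfc (fun w => ∑ z ∈ s, g z w) a = ∑ z ∈ s, x z := by
        rw [← cfc_sum g a s fun z _ => (hgc z).continuousOn]
        congr 1
        ext w
        simp
      rw [this, Finset.mul_sum]
      exact Finset.sum_eq_zero hrx
    have hu : IsUnit (cfc (fun w => ∑ z ∈ s, g z w) a) := by
      rw [isUnit_cfc_iff _ a (by fun_prop)]
      intro w hw
      have hcast : ∑ z ∈ s, g z w = ((∑ z ∈ s, max 0 (ε - ‖w - z‖) : ℝ) : ℂ) := by simp [hg]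
      rw [hcast]
      norm_cast
      obtain ⟨z, hz, hwz⟩ := Set.mem_iUnion₂.1 (hcov hw)
      refine (Finset.sum_pos' (fun _ _ => le_max_left _ _) ⟨z, hz, ?_⟩).ne'
      rw [Metric.mem_ball, dist_eq_norm] at hwz
      exact lt_max_of_lt_right (by linarith)
    exact (hu.mul_left_eq_zero).1 hsum
  refine ⟨s, e, fun z hz => (h1 z hz).1, h2, by simpa [hr] using h3,
    fun y hy1 hy2 => (h7 y (hyp y hy1 hy2)).2, fun z hz => ?_⟩
  -- `w - z` radially truncated to modulus at most `ε`; it agrees with `w - z` wherever `g z` is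
  -- nonzero.
  set k : ℂ → ℂ := fun w => (w - z) * ((ε / max ε ‖w - z‖ : ℝ) : ℂ) with hk
  have hpos : ∀ w, 0 < max ε ‖w - z‖ := fun w => lt_max_of_lt_left hε
  have hkc : Continuous k := by
    refine (by fun_prop : Continuous fun w : ℂ => w - z).mul (Complex.continuous_ofReal.comp ?_)
    exact continuous_const.div (by fun_prop) fun w => (hpos w).ne'
  have hkn : ‖cfc k a‖ ≤ ε := by
    refine norm_cfc_le hε.le fun w _ => ?_
    rw [hk, norm_mul, Complex.norm_real, Real.norm_of_nonneg (by have := hpos w; positivity),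
      ← mul_div_assoc, div_le_iff₀ (hpos w), mul_comm]
    exact mul_le_mul_of_nonneg_left (le_max_right _ _) hε.le
  have ha : a - z • 1 = cfc (fun w => w - z) a := by
    rw [cfc_sub _ _ a, cfc_id' ℂ a, cfc_const z a, Algebra.algebraMap_eq_smul_one]
  have hkx : (a - z • 1 - cfc k a) * x z = 0 := by
    rw [ha, ← cfc_sub _ _ a (by fun_prop) hkc.continuousOn,
      ← cfc_mul _ _ a (by fun_prop) (hgc z).continuousOn, ← cfc_zero ℂ a]
    congr 1
    ext w
    rcases le_total ε ‖w - z‖ with h | h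
    · simp [hg, h]
    · simp [hk, h, hε.ne']
  have hke : (a - z • 1) * e z = cfc k a * e z := by
    have h8 := (hpx z _).1 hkx
    rw [sub_mul, sub_eq_zero] at h8
    rw [← (h1 z hz).2, ← mul_assoc, ← mul_assoc, h8]
  rw [hke]
  calc _ ≤ ‖cfc k a‖ * ‖e z‖ := norm_mul_le _ _
    _ ≤ ε * 1 := mul_le_mul hkn ((h1 z hz).1.norm_le) (norm_nonneg _) hε.le
    _ = ε := mul_one ε

/-- A nonzero element `x` with `f * x = x = x * e` gives a nonzero partial isometry `w` with
`f * w = w = w * e`. -/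
lemma exists_partialIsometry (hA : HasLeftSupports A) {e f x : A} (he : IsSelfAdjoint e)
    (hx : x ≠ 0) (hfx : f * x = x) (hxe : x * e = x) :
    ∃ w ≠ 0, w * star w * w = w ∧ f * w = w ∧ w * e = w := by
  set h := star x * x with hh
  have hsa : IsSelfAdjoint h := .star_mul_self x
  have hn : 0 < ‖h‖ := by
    rw [hh, CStarRing.norm_star_mul_self]
    have := norm_pos_iff.2 hx
    positivity
  set δ := ‖h‖ / 2 with hδ
  have hδ0 : 0 < δ := by positivity
  have hmax : ∀ t : ℝ, 0 < max t δ := fun t => lt_max_of_lt_right hδ0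
  -- The polar part of `x` need not be reached by continuous functions of `h = x* x`, so the
  -- spectrum below `δ` is cut off. The cutoff `δ = ‖h‖ / 2` leaves `g(h) ≠ 0`.
  set g : ℝ → ℝ := fun t => max (t - δ) 0 with hg
  have hgc : Continuous g := by fun_prop
  have hg0 : cfc g h ≠ 0 := by
    intro h0
    have hle : ‖cfc (id : ℝ → ℝ) h‖ ≤ δ := by
      refine norm_cfc_le hδ0.le fun t ht => ?_
      have h1 := norm_apply_le_norm_cfc g h ht
      rw [h0, norm_zero, norm_le_zero_iff] at h1
      have h2 : t ≤ δ := by simpa [hg] using h1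
      have h3 : 0 ≤ t := spectrum_star_mul_self_nonneg t ht
      simpa [abs_of_nonneg h3] using h2
    rw [cfc_id ℝ h] at hle
    linarith
  obtain ⟨q, hq, hqg⟩ := hA (cfc g h)
  have hq0 : q ≠ 0 := by
    rintro rfl
    exact hg0 (by simpa using (hqg 1).2 (by simp))
  -- This is `t^{-1/2}` on the part of the spectrum seen by `q`, so `w = x k(h) q` has `w* w = q`.
  set k : ℝ → ℝ := fun t => (√(max t δ))⁻¹ with hk
  have hkc : Continuous k := by
    refine Continuous.inv₀ (by fun_prop) fun t => ?_
    exact (Real.sqrt_pos.2 (hmax t)).ne'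
  have hks : IsSelfAdjoint (cfc k h) := cfc_predicate k h
  have hqq : cfc k h * h * cfc k h * q = q := by
    have h1 : (cfc k h * h * cfc k h - 1) * cfc g h = 0 := by
      nth_rw 2 [← cfc_id' ℝ h]
      rw [← cfc_mul _ _ h hkc.continuousOn (by fun_prop),
        ← cfc_mul _ _ h (by fun_prop) hkc.continuousOn, ← cfc_one ℝ h,
        ← cfc_sub _ _ h (by fun_prop) (by fun_prop),
        ← cfc_mul _ _ h (by fun_prop) hgc.continuousOn, ← cfc_zero ℝ h]
      congr 1
      ext t
      rcases le_total t δ with h | h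
      · simp [hg, h]
      · have ht : 0 < t := hδ0.trans_le h
        have : (√t)⁻¹ * t * (√t)⁻¹ = 1 := by
          have := Real.sqrt_pos.2 ht
          field_simp
          rw [Real.sq_sqrt ht.le]
        simp [hk, h, this]
    have := (hqg _).1 h1
    rwa [sub_mul, one_mul, sub_eq_zero] at this
  have heh : (1 - e) * h = 0 := by
    have h1 := congrArg star hxe
    rw [star_mul, he.star_eq] at h1
    rw [hh, ← mul_assoc, sub_mul, one_mul, h1, sub_self, zero_mul]
  have heq : e * q = q := by
    have h1 : (1 - e) * cfc g h = 0 := by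
      have h2 : cfc g h = h * cfc (fun t => g t / max t δ) h := by
        have hc : Continuous fun t => g t / max t δ :=
          hgc.div (by fun_prop) fun t => (hmax t).ne'
        nth_rw 2 [← cfc_id' ℝ h]
        rw [← cfc_mul _ _ h (by fun_prop) hc.continuousOn]
        congr 1
        ext t
        rcases le_total t δ with h | h
        · simp [hg, h]
        · have ht : 0 < t := hδ0.trans_le h
          simp only [max_eq_left h]
          field_simp
      rw [h2, ← mul_assoc, heh, zero_mul]
    have := (hqg _).1 h1
    rw [sub_mul, one_mul, sub_eq_zero] at this
    exact this.symm
  have hww : star (x * cfc k h * q) * (x * cfc k h * q) = q := by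
    calc _ = q * (cfc k h * (star x * x) * cfc k h * q) := by
          simp only [star_mul, hks.star_eq, hq.isSelfAdjoint.star_eq, mul_assoc]
      _ = q := by rw [← hh, hqq, hq.isIdempotentElem.eq]
  refine ⟨x * cfc k h * q, ?_, ?_, ?_, ?_⟩
  · intro h0
    rw [h0, mul_zero] at hww
    exact hq0 hww.symm
  · rw [mul_assoc, hww, mul_assoc, hq.isIdempotentElem.eq]
  · rw [← mul_assoc, ← mul_assoc, hfx]
  · have := congrArg star heq
    rw [star_mul, he.star_eq, hq.isSelfAdjoint.star_eq] at this
    rw [mul_assoc, this]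

end CStar

/-! ### Faithful traces and comparison of projections. -/

/-- `τ` is a faithful tracial state. -/
structure IsFaithfulTracialState {A : Type*} [CStarAlgebra A] (τ : A →ₗ[ℂ] ℂ) : Prop where
  map_one : τ 1 = 1
  nonneg : ∀ x, 0 ≤ (τ (star x * x)).re
  tracial : ∀ x y, τ (x * y) = τ (y * x)
  faithful : ∀ x, (τ (star x * x)).re = 0 → x = 0

/-- Any two projections are comparable in the sense of Murray and von Neumann. -/
def HasComparison (A : Type*) [Mul A] [Star A] : Prop :=
  ∀ e f : A, IsStarProjection e → IsStarProjection f →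
    ∃ v : A, v * star v * v = v ∧ f * v = v ∧ v * e = v ∧ (star v * v = e ∨ v * star v = f)

section PartialIsometry

variable {A : Type*} [Ring A] [StarRing A] {e f v : A}

lemma isStarProjection_star_mul (hv : v * star v * v = v) : IsStarProjection (star v * v) :=
  ⟨by rw [IsIdempotentElem, mul_assoc, ← mul_assoc v, hv], .star_mul_self v⟩

lemma isStarProjection_mul_star (hv : v * star v * v = v) : IsStarProjection (v * star v) :=
  ⟨by rw [IsIdempotentElem, ← mul_assoc, hv], .mul_star_self v⟩

lemma isStarProjection_sub_mul_star (hf : IsStarProjection f) (hv : v * star v * v = v)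
    (hfv : f * v = v) : IsStarProjection (f - v * star v) :=
  (isStarProjection_mul_star hv).sub_of_mul_eq_right hf (by rw [← mul_assoc, hfv])

lemma isStarProjection_sub_star_mul (he : IsStarProjection e) (hv : v * star v * v = v)
    (hve : v * e = v) : IsStarProjection (e - star v * v) :=
  (isStarProjection_star_mul hv).sub_of_mul_eq_left he (by rw [mul_assoc, hve])

end PartialIsometry

section Trace

variable {A : Type*} [CStarAlgebra A] {τ τ' : A →ₗ[ℂ] ℂ}

lemma norm_le_one_of_partialIsometry {v : A} (hv : v * star v * v = v) : ‖v‖ ≤ 1 := by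
  have h := (isStarProjection_star_mul hv).norm_le
  rw [CStarRing.norm_star_mul_self] at h
  nlinarith [norm_nonneg v]

/-- In a prime algebra with support projections, comparison of projections follows from the
existence of partial isometries of maximal trace. -/
lemma hasComparison_of_exists_maximal (hA : HasLeftSupports A)
    (hprime : ∀ e f : A, (∀ y, f * y * e = 0) → e = 0 ∨ f = 0) (hτ : IsFaithfulTracialState τ)
    (hmax : ∀ e f : A, ∃ v : A, v * star v * v = v ∧ f * v = v ∧ v * e = v ∧
      ∀ w : A, w * star w * w = w → f * w = w → w * e = w →
        (τ (star w * w)).re ≤ (τ (star v * v)).re) : HasComparison A := by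
  intro e f he hf
  obtain ⟨v, hv, hfv, hve, hm⟩ := hmax e f
  refine ⟨v, hv, hfv, hve, ?_⟩
  set e' := e - star v * v with he'
  set f' := f - v * star v with hf'
  have hpe : IsStarProjection e' := isStarProjection_sub_star_mul he hv hve
  have hpf : IsStarProjection f' := isStarProjection_sub_mul_star hf hv hfv
  by_contra! hcon
  -- If neither remainder vanishes, primeness gives a nonzero partial isometry `w` from `e'` to
  -- `f'`. Then `v + w` is a partial isometry of larger trace, against maximality.
  have : ∃ y, f' * y * e' ≠ 0 := by
    by_contra! h0
    rcases hprime e' f' h0 with h | h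
    · exact hcon.1 (sub_eq_zero.1 h).symm
    · exact hcon.2 (sub_eq_zero.1 h).symm
  obtain ⟨y, hy⟩ := this
  obtain ⟨w, hw0, hw, hfw, hwe⟩ := exists_partialIsometry hA (e := e') (f := f')
    hpe.isSelfAdjoint hy
    (by rw [← mul_assoc, ← mul_assoc, hpf.isIdempotentElem.eq])
    (by rw [mul_assoc, hpe.isIdempotentElem.eq])
  have hff : f * f' = f' := by
    rw [hf', mul_sub, hf.isIdempotentElem.eq, ← mul_assoc, hfv]
  have hee : e' * e = e' := by
    rw [he', sub_mul, he.isIdempotentElem.eq, mul_assoc, hve]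
  have hve' : v * e' = 0 := by rw [he', mul_sub, hve, ← mul_assoc, hv, sub_self]
  have hfv' : f' * v = 0 := by rw [hf', sub_mul, hfv, hv, sub_self]
  have hvw : star v * w = 0 := by
    have := congrArg star hfv'
    rw [star_mul, hpf.isSelfAdjoint.star_eq, star_zero] at this
    rw [← hfw, ← mul_assoc, this, zero_mul]
  have hwv : star w * v = 0 := by simpa using congrArg star hvw
  have hvw' : v * star w = 0 := by
    have := congrArg star hwe
    rw [star_mul, hpe.isSelfAdjoint.star_eq] at this
    rw [← this, ← mul_assoc, hve', zero_mul]
  have hwv' : w * star v = 0 := by simpa using congrArg star hvw'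
  have hsq : star (v + w) * (v + w) = star v * v + star w * w := by
    rw [star_add, add_mul, mul_add, mul_add, hvw, hwv, add_zero, zero_add]
  have h1 := hm (v + w)
    (by rw [mul_assoc, hsq, add_mul, mul_add, mul_add, ← mul_assoc, ← mul_assoc, ← mul_assoc,
          ← mul_assoc, hv, hw, hvw', hwv', zero_mul, zero_mul, add_zero, zero_add])
    (by rw [mul_add, hfv, ← hfw, ← mul_assoc, hff])
    (by rw [add_mul, hve, ← hwe, mul_assoc w, hee])
  rw [hsq, map_add, Complex.add_re] at h1
  have h2 := hτ.nonneg w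
  exact hw0 (hτ.faithful w (by linarith))

namespace IsFaithfulTracialState

lemma re_nonneg (hτ : IsFaithfulTracialState τ) {p : A} (hp : IsStarProjection p) :
    0 ≤ (τ p).re := by
  have := hτ.nonneg p
  rwa [hp.isSelfAdjoint.star_eq, hp.isIdempotentElem.eq] at this

lemma eq_zero (hτ : IsFaithfulTracialState τ) {p : A} (hp : IsStarProjection p)
    (h : (τ p).re = 0) : p = 0 := by
  refine hτ.faithful p ?_
  rwa [hp.isSelfAdjoint.star_eq, hp.isIdempotentElem.eq]

lemma re_pos (hτ : IsFaithfulTracialState τ) {p : A} (hp : IsStarProjection p) (h : p ≠ 0) :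
    0 < (τ p).re :=
  (hτ.re_nonneg hp).lt_of_ne fun h0 => h (hτ.eq_zero hp h0.symm)

/-- Projections of equal trace are equivalent. -/
lemma exists_equivalence (hτ : IsFaithfulTracialState τ) (hA : HasComparison A) {e f : A}
    (he : IsStarProjection e) (hf : IsStarProjection f) (h : (τ e).re = (τ f).re) :
    ∃ v : A, star v * v = e ∧ v * star v = f ∧ f * v = v ∧ v * e = v := by
  obtain ⟨v, hv, hfv, hve, hor⟩ := hA e f he hf
  have htr := hτ.tracial (star v) v
  rcases hor with h1 | h1
  · refine ⟨v, h1, ?_, hfv, hve⟩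
    have := hτ.eq_zero (isStarProjection_sub_mul_star hf hv hfv)
      (by rw [map_sub, Complex.sub_re, ← htr, h1, h, sub_self])
    exact (sub_eq_zero.1 this).symm
  · refine ⟨v, ?_, h1, hfv, hve⟩
    have := hτ.eq_zero (isStarProjection_sub_star_mul he hv hve)
      (by rw [map_sub, Complex.sub_re, htr, h1, h, sub_self])
    exact (sub_eq_zero.1 this).symm

/-- `‖x z‖₂ ≤ ‖x‖ ‖z‖₂`. -/
lemma re_star_mul_le (hτ : IsFaithfulTracialState τ) (x z : A) :
    (τ (star (x * z) * (x * z))).re ≤ ‖x‖ ^ 2 * (τ (star z * z)).re := by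
  -- With `y* y = ‖x‖² - x* x`, the inequality is positivity of `τ ((y z)* (y z))`.
  set y := cfc (fun t : ℝ => √(‖x‖ ^ 2 - t)) (star x * x) with hy
  have hsa : IsSelfAdjoint y := cfc_predicate _ _
  have hyy : star y * y = ((‖x‖ ^ 2 : ℝ) : ℂ) • 1 - star x * x := by
    rw [hsa.star_eq, hy, ← cfc_mul _ _ (star x * x) (by fun_prop) (by fun_prop)]
    have h1 : (spectrum ℝ (star x * x)).EqOn
        (fun t => √(‖x‖ ^ 2 - t) * √(‖x‖ ^ 2 - t)) (fun t => ‖x‖ ^ 2 - t) := by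
      intro t ht
      refine Real.mul_self_sqrt ?_
      have := norm_apply_le_norm_cfc (id : ℝ → ℝ) (star x * x) ht
      rw [cfc_id ℝ (star x * x), CStarRing.norm_star_mul_self] at this
      have := (le_abs_self t).trans this
      nlinarith
    rw [cfc_congr h1, cfc_sub _ _ _ (by fun_prop) (by fun_prop), cfc_const _ _, cfc_id' ℝ _,
      Algebra.algebraMap_eq_smul_one, Complex.coe_smul]
  have h1 := hτ.nonneg (y * z)
  have h2 : star (y * z) * (y * z) =
      ((‖x‖ ^ 2 : ℝ) : ℂ) • (star z * z) - star (x * z) * (x * z) := by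
    calc _ = star z * (star y * y) * z := by simp only [star_mul, mul_assoc]
      _ = _ := by
        rw [hyy, mul_sub, sub_mul, mul_smul_comm, mul_one, smul_mul_assoc]
        simp only [star_mul, mul_assoc]
  rw [h2, map_sub, map_smul, Complex.sub_re, smul_eq_mul, Complex.re_ofReal_mul] at h1
  linarith

end IsFaithfulTracialState

/-! ### Division of projections and uniqueness of the trace. -/

/-- A projection is a sum of copies of a given nonzero projection and a smaller remainder. -/
lemma exists_euclidean_division (hτ : IsFaithfulTracialState τ) (hA : HasComparison A) {p : A}
    (hp : IsStarProjection p) (n : ℕ) :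
    ∀ e : A, IsStarProjection e → (τ e).re < n * (τ p).re →
    ∃ (k : ℕ) (v : Fin k → A) (w : A), (∀ i, star (v i) * v i = p ∧ v i * p = v i) ∧
      w * star w * w = w ∧ w * p = w ∧ e = ∑ i, v i * star (v i) + w * star w := by
  induction n with
  | zero =>
    intro e he h
    have := hτ.re_nonneg he
    simp only [Nat.cast_zero, zero_mul] at h
    linarith
  | succ n ih =>
    intro e he h
    -- Either `p` embeds in `e`, and removing that copy lowers the trace by `τ p`, or `e` is
    -- equivalent to a subprojection of `p` and becomes the remainder.
    obtain ⟨v, hv, hev, hvp, hor⟩ := hA p e hp he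
    rcases hor with h1 | h1
    · obtain ⟨k, u, w, h2, h3, h4, h5⟩ := ih (e - v * star v)
        (isStarProjection_sub_mul_star he hv hev) (by
          rw [map_sub, Complex.sub_re, ← hτ.tracial, h1]
          push_cast at h
          linarith)
      refine ⟨k + 1, Fin.cons v u, w, ?_, h3, h4, ?_⟩
      · intro i
        refine Fin.cases ⟨h1, hvp⟩ (fun i => ?_) i
        simpa using h2 i
      · rw [Fin.sum_univ_succ]
        simp only [Fin.cons_zero, Fin.cons_succ]
        rw [add_assoc, ← h5]
        abel
    · exact ⟨0, Fin.elim0, v, fun i => i.elim0, hv, hvp, by simp [h1]⟩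

/-- The trace of a projection, up to the trace of `p`, is an integer multiple of the latter, and
the integer does not depend on the trace. -/
lemma exists_trace_division (hτ : IsFaithfulTracialState τ) (hA : HasComparison A) {p e : A}
    (hp : IsStarProjection p) (hp0 : p ≠ 0) (he : IsStarProjection e) :
    ∃ k : ℕ, ∀ σ : A →ₗ[ℂ] ℂ, IsFaithfulTracialState σ →
      k * (σ p).re ≤ (σ e).re ∧ (σ e).re ≤ (k + 1) * (σ p).re := by
  obtain ⟨n, hn⟩ := exists_nat_gt ((τ e).re / (τ p).re)
  rw [div_lt_iff₀ (hτ.re_pos hp hp0)] at hn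
  -- The decomposition is purely algebraic, so the same `k` serves every `σ`.
  obtain ⟨k, v, w, h1, h2, h3, h4⟩ := exists_euclidean_division hτ hA hp n e he hn
  refine ⟨k, fun σ hσ => ?_⟩
  have hsum : (σ e).re = k * (σ p).re + (σ (star w * w)).re := by
    rw [h4, map_add, map_sum, hσ.tracial w]
    have : ∀ i, σ (v i * star (v i)) = σ p := fun i => by rw [hσ.tracial, (h1 i).1]
    simp [this]
  have hw := hσ.nonneg w
  have hw' := hσ.re_nonneg (isStarProjection_sub_star_mul hp h2 h3)
  rw [map_sub, Complex.sub_re] at hw'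
  constructor <;> linarith

/-- The corner of a minimal projection is one-dimensional. -/
lemma mem_span_of_minimal (hA : HasLeftSupports A) {p : A} (hp : IsStarProjection p)
    (hmin : ∀ q : A, IsStarProjection q → p * q = q → q = 0 ∨ q = p) (x : A) :
    p * x * p ∈ Submodule.span ℂ {p} := by
  have key : ∀ h : A, IsSelfAdjoint h → p * h = h → h ∈ Submodule.span ℂ {p} := by
    intro h hh hph
    have hhp : h * p = h := by
      simpa [hh.star_eq, hp.isSelfAdjoint.star_eq] using congrArg star hph
    have hcl : IsClosed (Submodule.span ℂ {p} : Set A) := Submodule.closed_of_finiteDimensional _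
    rw [← SetLike.mem_coe, ← hcl.closure_eq, Metric.mem_closure_iff]
    intro ε hε
    have hnorm := hh.isStarNormal
    -- Each `p * e z` is a subprojection of `p`, so by minimality it is `0` or `p`. If some `p * e
    -- z` equals `p`, then `h` is within `ε / 2` of `z • p`; otherwise `p = 0`.
    obtain ⟨s, e, h1, -, h3, h4, h5⟩ := exists_spectral_partition hA h (half_pos hε)
    have hcomm : Commute p h := by rw [Commute, SemiconjBy, hph, hhp]
    have hpe := h4 p hcomm (by rwa [hh.star_eq])
    by_cases hall : ∀ z ∈ s, p * e z = 0
    · have hp0 : p = 0 := by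
        rw [← mul_one p, ← h3, Finset.mul_sum]
        exact Finset.sum_eq_zero hall
      refine ⟨0, Submodule.zero_mem _, ?_⟩
      rw [← hph, hp0, zero_mul, dist_self]
      exact hε
    · push Not at hall
      obtain ⟨z, hz, hz0⟩ := hall
      have hez : p * e z = p := (hmin _ (hp.mul (h1 z hz) (hpe z hz))
        (by rw [← mul_assoc, hp.isIdempotentElem.eq])).resolve_left hz0
      refine ⟨z • p, Submodule.smul_mem _ _ (Submodule.mem_span_singleton_self p), ?_⟩
      have h6 : h - z • p = (h - z • 1) * e z * p := by
        rw [mul_assoc, ← (hpe z hz).eq, hez, sub_mul, hhp, smul_mul_assoc, one_mul]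
      rw [dist_eq_norm, h6]
      calc _ ≤ ‖(h - z • 1) * e z‖ * ‖p‖ := norm_mul_le _ _
        _ ≤ ε / 2 * 1 := mul_le_mul (h5 z hz) hp.norm_le (norm_nonneg _) (half_pos hε).le
        _ < ε := by linarith
  have hcorner : ∀ y : A, IsSelfAdjoint y → p * y * p ∈ Submodule.span ℂ {p} := fun y hy => by
    refine key _ ?_ (by rw [← mul_assoc, ← mul_assoc, hp.isIdempotentElem.eq])
    simp only [IsSelfAdjoint, star_mul, hp.isSelfAdjoint.star_eq, hy.star_eq, mul_assoc]
  rw [← realPart_add_I_smul_imaginaryPart x, mul_add, add_mul, mul_smul_comm, smul_mul_assoc]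
  exact add_mem (hcorner _ (realPart x).2) (Submodule.smul_mem _ _ (hcorner _ (imaginaryPart x).2))

/-- An infinite-dimensional algebra with comparison has projections of arbitrarily small trace. -/
lemma exists_projection_trace_lt (hA : HasLeftSupports A) (hC : HasComparison A)
    (hτ : IsFaithfulTracialState τ) (hinf : ¬ FiniteDimensional ℂ A) {ε : ℝ} (hε : 0 < ε) :
    ∃ p : A, IsStarProjection p ∧ p ≠ 0 ∧ (τ p).re < ε := by
  by_contra! hcon
  have hne1 : (1 : A) ≠ 0 := fun h => by
    have := hτ.map_one
    rw [h, map_zero] at this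
    exact zero_ne_one this
  have hex : ∃ n : ℕ, ∃ p : A, IsStarProjection p ∧ p ≠ 0 ∧ (τ p).re < n * ε := by
    obtain ⟨n, hn⟩ := exists_nat_gt ((τ (1 : A)).re / ε)
    exact ⟨n, 1, .one A, hne1, (div_lt_iff₀ hε).1 hn⟩
  classical
  -- For the least such `n`, `p` is minimal: a proper nonzero `q ≤ p` leaves `p - q` of trace at
  -- least `ε`, so `q` would already occur for `n - 1`.
  obtain ⟨p, hp, hp0, hpn⟩ := Nat.find_spec hex
  have hmin : ∀ q : A, IsStarProjection q → p * q = q → q = 0 ∨ q = p := by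
    intro q hq hpq
    by_contra! hq'
    have hpq' : IsStarProjection (p - q) := hq.sub_of_mul_eq_right hp hpq
    have h1 := hcon _ hpq' (sub_ne_zero.2 hq'.2.symm)
    rw [map_sub, Complex.sub_re] at h1
    have h0 : Nat.find hex ≠ 0 := by
      intro h0
      rw [h0, Nat.cast_zero, zero_mul] at hpn
      linarith [hτ.re_nonneg hp]
    obtain ⟨m, hm⟩ := Nat.exists_eq_succ_of_ne_zero h0
    refine Nat.find_min hex (m := m) (by omega) ⟨q, hq, hq'.1, ?_⟩
    rw [hm] at hpn
    push_cast at hpn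
    linarith
  apply hinf
  obtain ⟨n, hn⟩ := exists_nat_gt ((τ (1 : A)).re / (τ p).re)
  rw [div_lt_iff₀ (hτ.re_pos hp hp0)] at hn
  obtain ⟨k, v, w, h1, -, h3, h4⟩ := exists_euclidean_division hτ hC hp n 1 (.one A) hn
  -- With the remainder included, `1 = ∑ u i u i*`. Since `p A p` is one-dimensional, the finitely
  -- many `u i p u j*` span `A`.
  set u : Fin (k + 1) → A := Fin.cons w v with hu
  have hup : ∀ i, u i * p = u i := fun i => Fin.cases h3 (fun i => (h1 i).2) i
  have hpu : ∀ i, p * star (u i) = star (u i) := fun i => by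
    simpa [hp.isSelfAdjoint.star_eq] using congrArg star (hup i)
  have hu1 : 1 = ∑ i, u i * star (u i) := by
    rw [Fin.sum_univ_succ, h4]
    simp [hu, add_comm]
  have htop : Submodule.span ℂ (Set.range fun ij : Fin (k + 1) × Fin (k + 1) =>
      u ij.1 * p * star (u ij.2)) = ⊤ := by
    refine eq_top_iff.2 fun x _ => ?_
    have hx : x = ∑ i, ∑ j, u i * (p * (star (u i) * x * u j) * p) * star (u j) := by
      calc x = (∑ i, u i * star (u i)) * x * ∑ j, u j * star (u j) := by
            rw [← hu1, one_mul, mul_one]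
        _ = ∑ i, ∑ j, (u i * star (u i)) * x * (u j * star (u j)) := by
            simp_rw [Finset.sum_mul, Finset.mul_sum]
        _ = _ := by
            refine Finset.sum_congr rfl fun i _ => Finset.sum_congr rfl fun j _ => ?_
            calc _ = u i * p * star (u i) * x * (u j * (p * star (u j))) := by
                  rw [hup, hpu]
              _ = _ := by simp only [mul_assoc]
    rw [hx]
    refine Submodule.sum_mem _ fun i _ => Submodule.sum_mem _ fun j _ => ?_
    obtain ⟨c, hc⟩ := Submodule.mem_span_singleton.1
      (mem_span_of_minimal hA hp hmin (star (u i) * x * u j))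
    rw [← hc, mul_smul_comm, smul_mul_assoc]
    exact Submodule.smul_mem _ _ (Submodule.subset_span ⟨(i, j), rfl⟩)
  exact ⟨Submodule.fg_def.2 ⟨_, Set.finite_range _, htop⟩⟩

/-- The trace on projections is unique. -/
lemma trace_projection_unique (hA : HasLeftSupports A) (hC : HasComparison A)
    (hτ : IsFaithfulTracialState τ) (hτ' : IsFaithfulTracialState τ')
    (hinf : ¬ FiniteDimensional ℂ A) {e : A} (he : IsStarProjection e) :
    (τ e).re = (τ' e).re := by
  have key : ∀ e : A, IsStarProjection e → (τ e).re ≤ (τ' e).re := by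
    intro e he
    refine le_of_forall_pos_le_add fun ε hε => ?_
    obtain ⟨p, hp, hp0, hpε⟩ := exists_projection_trace_lt hA hC hτ hinf (half_pos hε)
    obtain ⟨m, hm⟩ := exists_trace_division hτ hC hp hp0 (.one A)
    obtain ⟨k, hk⟩ := exists_trace_division hτ hC hp hp0 he
    have h1 := hm τ hτ
    have h2 := hm τ' hτ'
    have h3 := hk τ hτ
    have h4 := hk τ' hτ'
    have hle : (τ e).re ≤ 1 := by
      have := hτ.re_nonneg he.one_sub
      rw [map_sub, hτ.map_one, Complex.sub_re, Complex.one_re] at this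
      linarith
    rw [hτ.map_one, Complex.one_re] at h1
    rw [hτ'.map_one, Complex.one_re] at h2
    have ht := hτ.re_pos hp hp0
    have ht' := hτ'.re_pos hp hp0
    have hkm : (k : ℝ) ≤ m + 1 := by
      by_contra! h
      nlinarith
    rcases le_total (τ p).re (τ' p).re with h | h
    · have : (k : ℝ) * (τ p).re ≤ k * (τ' p).re := mul_le_mul_of_nonneg_left h k.cast_nonneg
      linarith
    -- From `m τ(p) ≤ 1 ≤ (m + 1) τ'(p)` the right side is at most `τ(p)`. Hence `τ(e) ≤ τ'(e) + 2
    -- τ(p)`, which explains the choice `τ(p) < ε / 2`.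
    · have : (k : ℝ) * ((τ p).re - (τ' p).re) ≤ (m + 1) * ((τ p).re - (τ' p).re) :=
        mul_le_mul_of_nonneg_right hkm (by linarith)
      linarith
  refine le_antisymm (key e he) ?_
  have := key _ he.one_sub
  rw [map_sub, map_sub, hτ.map_one, hτ'.map_one, Complex.sub_re, Complex.sub_re] at this
  linarith

end Trace

/-! ### Approximate unitary conjugation. -/

/-- Automorphisms act on normal elements by unitary conjugation, approximately in the
`2`-norm. -/
lemma exists_unitary_approx {A : Type*} [CStarAlgebra A] {τ : A →ₗ[ℂ] ℂ} (hA : HasLeftSupports A)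
    (hC : HasComparison A) (hτ : IsFaithfulTracialState τ) (hinf : ¬ FiniteDimensional ℂ A)
    (β : A ≃⋆ₐ[ℂ] A) (a : A) [IsStarNormal a] {ε : ℝ} (hε : 0 < ε) :
    ∃ u ∈ unitary A,
      (τ (star (u * a * star u - β a) * (u * a * star u - β a))).re ≤ ε ^ 2 := by
  let βl : A →ₗ[ℂ] A := { toFun := β, map_add' := map_add β, map_smul' := map_smul β }
  -- Uniqueness of the trace on projections, applied to `τ` and `τ ∘ β`, gives `τ (e z) = τ (β (e
  -- z))`.
  have hτβ : IsFaithfulTracialState (τ ∘ₗ βl) :=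
    { map_one := by simp [βl, hτ.map_one]
      nonneg := fun x => by simpa [βl, map_star] using hτ.nonneg (β x)
      tracial := fun x y => by simpa [βl] using hτ.tracial (β x) (β y)
      faithful := fun x hx => by
        have := hτ.faithful (β x) (by simpa [βl, map_star] using hx)
        simpa using this }
  have hβ : ∀ x, ‖β x‖ = ‖x‖ := fun x => NonUnitalStarAlgHom.norm_map β β.injective x
  obtain ⟨s, e, h1, h2, h3, -, h5⟩ := exists_spectral_partition hA a (half_pos hε)
  have hf : ∀ z ∈ s, IsStarProjection (β (e z)) := fun z hz => (h1 z hz).map β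
  have hff : ∑ z ∈ s, β (e z) = 1 := by rw [← map_sum, h3, map_one]
  have hforth : ∀ z ∈ s, ∀ w ∈ s, z ≠ w → β (e z) * β (e w) = 0 := fun z hz w hw h => by
    rw [← map_mul, h2 z hz w hw h, map_zero]
  have hex : ∀ z, ∃ v : A, z ∈ s → star v * v = e z ∧ v * star v = β (e z) ∧
      β (e z) * v = v ∧ v * e z = v := by
    intro z
    by_cases hz : z ∈ s
    · obtain ⟨v, hv⟩ := hτ.exists_equivalence hC (h1 z hz) (hf z hz)
        (trace_projection_unique hA hC hτ hτβ hinf (h1 z hz))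
      exact ⟨v, fun _ => hv⟩
    · exact ⟨0, fun h => absurd h hz⟩
  choose v hv using hex
  have hstar : ∀ z ∈ s, star (v z) * β (e z) = star (v z) := fun z hz => by
    simpa [(hf z hz).isSelfAdjoint.star_eq] using congrArg star (hv z hz).2.2.1
  have hstar' : ∀ z ∈ s, e z * star (v z) = star (v z) := fun z hz => by
    simpa [(h1 z hz).isSelfAdjoint.star_eq] using congrArg star (hv z hz).2.2.2
  set u := ∑ z ∈ s, v z with hu
  have hu1 : star u * u = 1 := by
    rw [hu, star_sum, Finset.sum_mul_sum, ← h3]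
    refine Finset.sum_congr rfl fun z hz => ?_
    rw [Finset.sum_eq_single_of_mem z hz, (hv z hz).1]
    intro w hw hwz
    rw [← hstar z hz, ← (hv w hw).2.2.1, mul_assoc, ← mul_assoc (β (e z)),
      hforth z hz w hw hwz.symm, zero_mul, mul_zero]
  have hu2 : u * star u = 1 := by
    rw [hu, star_sum, Finset.sum_mul_sum, ← hff]
    refine Finset.sum_congr rfl fun z hz => ?_
    rw [Finset.sum_eq_single_of_mem z hz, (hv z hz).2.1]
    intro w hw hwz
    rw [← hstar' w hw, ← (hv z hz).2.2.2, mul_assoc, ← mul_assoc (e z),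
      h2 z hz w hw hwz.symm, zero_mul, mul_zero]
  have huU : u ∈ unitary A := ⟨hu1, hu2⟩
  have hcomm : ∀ z ∈ s, star u * β (e z) = e z * star u := by
    intro z hz
    rw [hu, star_sum, Finset.sum_mul, Finset.mul_sum, Finset.sum_eq_single_of_mem z hz,
      Finset.sum_eq_single_of_mem z hz, hstar z hz, hstar' z hz]
    · intro w hw hwz
      rw [← hstar' w hw, ← mul_assoc, h2 z hz w hw hwz.symm, zero_mul]
    · intro w hw hwz
      rw [← hstar w hw, mul_assoc, hforth w hw z hz hwz, mul_zero]
  refine ⟨u, huU, ?_⟩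
  set D := u * a * star u - β a with hD
  -- On the block `β (e z)` the scalar `z` cancels between the two terms of `D`, leaving two errors
  -- of norm at most `ε / 2` each.
  have hDz : ∀ z ∈ s, D * β (e z) =
      (u * ((a - z • 1) * e z) * star u - β ((a - z • 1) * e z)) * β (e z) := by
    intro z hz
    have hee := (h1 z hz).isIdempotentElem.eq
    have h6 : (u * ((a - z • 1) * e z) * star u) * β (e z) =
        u * a * star u * β (e z) - z • β (e z) := by
      calc _ = u * ((a - z • 1) * (e z * e z)) * star u := by
            rw [mul_assoc, hcomm z hz]
            simp only [mul_assoc]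
        _ = u * (a * (e z * star u)) - z • (u * (e z * star u)) := by
            rw [hee]
            simp only [sub_mul, mul_sub, smul_mul_assoc, mul_smul_comm, one_mul, mul_assoc]
        _ = _ := by
            rw [← hcomm z hz, ← mul_assoc u (star u), hu2, one_mul]
            simp only [mul_assoc]
    have h7 : β ((a - z • 1) * e z) * β (e z) = β a * β (e z) - z • β (e z) := by
      rw [← map_mul, mul_assoc, hee, sub_mul, smul_mul_assoc, one_mul, map_sub, map_mul,
        map_smul]
    rw [hD, sub_mul, sub_mul (u * ((a - z • 1) * e z) * star u), h6, h7]
    abel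
  have hDn : ∀ z ∈ s, ‖u * ((a - z • 1) * e z) * star u - β ((a - z • 1) * e z)‖ ≤ ε := by
    intro z hz
    refine (norm_sub_le _ _).trans ?_
    rw [hβ, CStarRing.norm_mul_mem_unitary _ (Unitary.star_mem huU),
      CStarRing.norm_mem_unitary_mul _ huU]
    linarith [h5 z hz]
  -- Pythagoras over the blocks: the squared errors add up with weights `τ (β (e z))` of total `1`,
  -- so the bound does not depend on the number of blocks.
  have hsum : τ (star D * D) = ∑ z ∈ s, τ (star (D * β (e z)) * (D * β (e z))) := by
    calc τ (star D * D) = τ (star D * D * ∑ z ∈ s, β (e z)) := by rw [hff, mul_one]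
      _ = ∑ z ∈ s, τ (star D * D * β (e z)) := by rw [Finset.mul_sum, map_sum]
      _ = _ := by
        refine Finset.sum_congr rfl fun z hz => ?_
        have hp := hf z hz
        rw [star_mul, hp.isSelfAdjoint.star_eq, mul_assoc (β (e z)), hτ.tracial (β (e z))]
        congr 1
        simp only [mul_assoc, hp.isIdempotentElem.eq]
  rw [hsum, Complex.re_sum]
  calc _ ≤ ∑ z ∈ s, ε ^ 2 * (τ (β (e z))).re := by
        refine Finset.sum_le_sum fun z hz => ?_
        rw [hDz z hz]
        refine (hτ.re_star_mul_le _ _).trans ?_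
        have hp := hf z hz
        rw [hp.isSelfAdjoint.star_eq, hp.isIdempotentElem.eq]
        refine mul_le_mul_of_nonneg_right ?_ (hτ.re_nonneg hp)
        exact pow_le_pow_left₀ (norm_nonneg _) (hDn z hz) 2
    _ = ε ^ 2 := by
        rw [← Finset.mul_sum, ← Complex.re_sum, ← map_sum, hff, hτ.map_one, Complex.one_re,
          mul_one]

/-! ### The two applications of saturation. -/

namespace VonNeumannAlgebra

variable {H : Type*} [NormedAddCommGroup H] [InnerProductSpace ℂ H] [CompleteSpace H]
  {M : VonNeumannAlgebra H} {τ : M.toStarSubalgebra →ₗ[ℂ] ℂ}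

lemma twoNorm_eq_zero (hτ : IsFaithfulNormalTrace M τ) {x : M.toStarSubalgebra}
    (h : twoNorm τ x = 0) : x = 0 := by
  have h1 := hτ.nonneg x
  exact hτ.faithful x (Complex.ext ((Real.sqrt_eq_zero h1.1).1 h) h1.2)

lemma twoNorm_zero : twoNorm τ 0 = 0 := by simp [twoNorm]

/-- Partial isometries of maximal trace between given supports exist in a countably saturated
tracial von Neumann algebra. -/
lemma IsCountablySaturated.exists_maximal_partialIsometry (hsat : M.IsCountablySaturated τ)
    (hτ : IsFaithfulNormalTrace M τ)
    (hbdd : ∀ v : M.toStarSubalgebra, v * star v * v = v →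
      v ∈ M.domainBall 1 ∧ (τ (star v * v)).re ≤ 1) (e f : M.toStarSubalgebra) :
    ∃ v : M.toStarSubalgebra, v * star v * v = v ∧ f * v = v ∧ v * e = v ∧
      ∀ w : M.toStarSubalgebra, w * star w * w = w → f * w = w → w * e = w →
        (τ (star w * w)).re ≤ (τ (star v * v)).re := by
  set S : Set ℝ := {r | ∃ v : M.toStarSubalgebra, v * star v * v = v ∧ f * v = v ∧ v * e = v ∧
    r = (τ (star v * v)).re} with hS
  have hSne : S.Nonempty := ⟨0, 0, by simp⟩
  have hSbdd : BddAbove S := ⟨1, by rintro _ ⟨v, hv, -, -, rfl⟩; exact (hbdd v hv).2⟩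
  set X : Set M.toStarSubalgebra := {e, f} with hX
  let tx : TracialTerm X 1 := .var 0
  let te : TracialTerm X 1 := .param ⟨e, by simp [hX]⟩
  let tf : TracialTerm X 1 := .param ⟨f, by simp [hX]⟩
  let c₁ : TracialFormula X 1 × ℝ := (.dist (.mul (.mul tx (.star tx)) tx) tx, 0)
  let c₂ : TracialFormula X 1 × ℝ := (.dist (.mul tf tx) tx, 0)
  let c₃ : TracialFormula X 1 × ℝ := (.dist (.mul tx te) tx, 0)
  let c₄ : TracialFormula X 1 × ℝ := (.reTrace (.mul (.star tx) tx), sSup S)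
  -- A partial isometry of trace within `ε` of the supremum satisfies `c₁`, `c₂`, `c₃` exactly and
  -- `c₄` up to `ε`; a realization attains the supremum.
  obtain ⟨v, -, hv⟩ := hsat X (Set.toFinite _).countable 1 (fun _ => 1) {c₁, c₂, c₃, c₄} (by
    intro p₀ hp₀ _ ε hε
    obtain ⟨_, ⟨v, h1, h2, h3, rfl⟩, hlt⟩ := exists_lt_of_lt_csSup hSne (sub_lt_self (sSup S) hε)
    refine ⟨fun _ => v, fun _ => (hbdd v h1).1, fun c hc => ?_⟩
    rcases hp₀ hc with rfl | rfl | rfl | rfl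
    · simpa [c₁, tx, formulaVal, termVal, h1, twoNorm_zero] using hε
    · simpa [c₂, tx, tf, formulaVal, termVal, h2, twoNorm_zero] using hε
    · simpa [c₃, tx, te, formulaVal, termVal, h3, twoNorm_zero] using hε
    · have hle := le_csSup hSbdd ⟨v, h1, h2, h3, rfl⟩
      simp only [c₄, tx, formulaVal, termVal]
      rw [abs_lt]
      constructor <;> linarith)
  have h1 : v 0 * star (v 0) * v 0 = v 0 :=
    sub_eq_zero.1 (twoNorm_eq_zero hτ (hv c₁ (by simp)))
  have h2 : f * v 0 = v 0 := sub_eq_zero.1 (twoNorm_eq_zero hτ (hv c₂ (by simp)))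
  have h3 : v 0 * e = v 0 := sub_eq_zero.1 (twoNorm_eq_zero hτ (hv c₃ (by simp)))
  have h4 : (τ (star (v 0) * v 0)).re = sSup S := hv c₄ (by simp)
  refine ⟨v 0, h1, h2, h3, fun w hw1 hw2 hw3 => ?_⟩
  rw [h4]
  exact le_csSup hSbdd ⟨w, hw1, hw2, hw3, rfl⟩

/-- Approximate unitary equivalence in a countably saturated tracial von Neumann algebra is
unitary equivalence. -/
lemma IsCountablySaturated.exists_unitary_conjugate (hsat : M.IsCountablySaturated τ)
    (hτ : IsFaithfulNormalTrace M τ) (a b : M.toStarSubalgebra)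
    (h : ∀ ε : ℝ, 0 < ε → ∃ u ∈ unitary M.toStarSubalgebra, u ∈ M.domainBall 1 ∧
      twoNorm τ (u * a * star u - b) < ε) :
    ∃ u ∈ unitary M.toStarSubalgebra, u * a * star u = b := by
  set X : Set M.toStarSubalgebra := {a, b} with hX
  let tx : TracialTerm X 1 := .var 0
  let ta : TracialTerm X 1 := .param ⟨a, by simp [hX]⟩
  let tb : TracialTerm X 1 := .param ⟨b, by simp [hX]⟩
  let c₁ : TracialFormula X 1 × ℝ := (.dist (.mul (.star tx) tx) .one, 0)
  let c₂ : TracialFormula X 1 × ℝ := (.dist (.mul tx (.star tx)) .one, 0)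
  let c₃ : TracialFormula X 1 × ℝ := (.dist (.mul (.mul tx ta) (.star tx)) tb, 0)
  obtain ⟨v, -, hv⟩ := hsat X (Set.toFinite _).countable 1 (fun _ => 1) {c₁, c₂, c₃} (by
    intro p₀ hp₀ _ ε hε
    obtain ⟨u, hu, hu1, hua⟩ := h ε hε
    refine ⟨fun _ => u, fun _ => hu1, fun c hc => ?_⟩
    rcases hp₀ hc with rfl | rfl | rfl
    · simpa [c₁, tx, formulaVal, termVal, Unitary.star_mul_self_of_mem hu, twoNorm_zero] using hε
    · simpa [c₂, tx, formulaVal, termVal, Unitary.mul_star_self_of_mem hu, twoNorm_zero] using hε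
    · simp only [c₃, tx, ta, tb, formulaVal, termVal, sub_zero]
      exact (abs_of_nonneg (Real.sqrt_nonneg _)).trans_lt hua)
  exact ⟨v 0, ⟨sub_eq_zero.1 (twoNorm_eq_zero hτ (hv c₁ (by simp))),
    sub_eq_zero.1 (twoNorm_eq_zero hτ (hv c₂ (by simp)))⟩,
    sub_eq_zero.1 (twoNorm_eq_zero hτ (hv c₃ (by simp)))⟩

end VonNeumannAlgebra

theorem proposition2p1 {H : Type*} [NormedAddCommGroup H] [InnerProductSpace ℂ H]
    [CompleteSpace H] (M : VonNeumannAlgebra H) (τ : M.toStarSubalgebra →ₗ[ℂ] ℂ)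
    (hM : IsTypeIIOneFactor M τ) (hsat : M.IsCountablySaturated τ)
    (β : M.toStarSubalgebra ≃⋆ₐ[ℂ] M.toStarSubalgebra)
    (a : M.toStarSubalgebra) (ha : IsStarNormal a) :
    ∃ u ∈ unitary M.toStarSubalgebra, u * a * star u = β a := by
  -- Norm-closedness provides the C⋆-algebra structure on `M` that the general lemmas require.
  have : IsClosed (M.toStarSubalgebra : Set (H →L[ℂ] H)) := M.isClosed_toStarSubalgebra
  have hτ : IsFaithfulTracialState τ :=
    { map_one := hM.isTrace.map_one
      nonneg := fun x => (hM.isTrace.nonneg x).1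
      tracial := hM.isTrace.tracial
      faithful := fun x hx => hM.isTrace.faithful x (Complex.ext hx (hM.isTrace.nonneg x).2) }
  have hA : HasLeftSupports M.toStarSubalgebra := M.exists_leftSupport
  have hball : ∀ v : M.toStarSubalgebra, ‖v‖ ≤ 1 → v ∈ M.domainBall 1 := fun v hv => by
    change ‖v‖ ≤ (((1 : ℕ+) : ℕ) : ℝ)
    simpa using hv
  have hC : HasComparison M.toStarSubalgebra :=
    hasComparison_of_exists_maximal hA hM.isFactor.eq_zero_or_eq_zero hτ
      (hsat.exists_maximal_partialIsometry hM.isTrace fun v hv =>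
        ⟨hball v (norm_le_one_of_partialIsometry hv), by
          have := hτ.re_nonneg (isStarProjection_star_mul hv).one_sub
          rw [map_sub, hτ.map_one, Complex.sub_re, Complex.one_re] at this
          linarith⟩)
  refine hsat.exists_unitary_conjugate hM.isTrace a (β a) fun ε hε => ?_
  obtain ⟨u, hu, hle⟩ := exists_unitary_approx hA hC hτ hM.infinite_dimensional β a (half_pos hε)
  refine ⟨u, hu, hball u (norm_le_one_of_partialIsometry (by rw [hu.2, one_mul])), ?_⟩
  calc VonNeumannAlgebra.twoNorm τ (u * a * star u - β a) ≤ ε / 2 :=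
        Real.sqrt_le_iff.2 ⟨(half_pos hε).le, hle⟩
    _ < ε := half_lt_self hε
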